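/- A pree is a set $P$ with a partial multiplication (a map to $P$ from a subset of $P\times P$, written $(a,b)\mapsto ab$) such that: there is an identity $1\in P$, i.e. $1a$ and $a1$ are defined and equal to $a$ for all $a\in P$; every $a\in P$ has a two-sided inverse $a^{-1}\in P$, i.e. $aa^{-1}$ and $a^{-1}a$ are defined and equal to $1$; and whenever $ab$ and $bc$ are defined, $(ab)c$ is defined if and only if $a(bc)$ is defined, in which case $(ab)c=a(bc)$. For $n\in\{4,5\}$ let Axiom A($n$) be the following condition: if $a_1,\dots,a_n\in P$ are such that all the products $b_i=a_i^{-1}a_{i+1}$, $1\le i\le n$, are defined (indices read modulo $n$), then at least one of the products $b_ib_{i+1}$ (indices read modulo $n$) is defined. The universal group $U(P)$ is the group with generating set $P$ and relators $abc^{-1}$, one for every product $ab=c$ defined in $P$; write $\overline a$ for the image of $a\in P$ in $U(P)$. Theorem. Let $P$ be a pree that satisfies Axioms A(4) and A(5). Then the canonical map $P\to U(P)$, $a\mapsto\overline a$, is injective. Moreover, the multiplication in $P$ is induced by the multiplication in $U(P)$: for all $a,b,c\in P$, the product $ab$ is defined in $P$ and equal to $c$ if and only if $\overline a\,\overline b=\overline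 c$ in $U(P)$. -/

import Mathlib

/-- A pree: a set `P` with a partial multiplication having an identity, two-sided inverses and
satisfying the restricted associative law. The value `pmul a b = none` means that the product
`ab` is not defined, and `pmul a b = some c` means that it is defined and equal to `c`. -/
class Pree (P : Type*) where
  /-- the partial multiplication -/
  pmul : P → P → Option P
  /-- the identity -/
  one : P
  /-- the inverse -/
  inv : P → P
  one_pmul : ∀ a : P, pmul one a = some a
  pmul_one : ∀ a : P, pmul a one = some a
  inv_pmul : ∀ a : P, pmul (inv a) a = some one
  pmul_inv : ∀ a : P, pmul a (inv a) = some one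
  /-- If `ab = x` and `bc = y` are defined, then `xc` is defined if and only if `ay` is, and
  in that case they are equal (this is what equality in `Option P` says). -/
  assoc : ∀ a b c x y : P, pmul a b = some x → pmul b c = some y → pmul x c = pmul a y

namespace Pree

/-- The product `ab` is defined. -/
def Defined {P : Type*} [Pree P] (a b : P) : Prop :=
  ∃ c : P, pmul a b = some c

/-- Axiom A(n): if the products `a i⁻¹ * a (i + 1) = b i` are all defined, then at least one of
the products `b i * b (i + 1)` is defined. The addition in `Fin n` is modulo `n`, so that the
indices are read cyclically. -/
def AxiomA (P : Type*) [Pree P] (n : ℕ) [NeZero n] : Prop :=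
  ∀ a b : Fin n → P, (∀ i : Fin n, pmul (inv (a i)) (a (i + 1)) = some (b i)) →
    ∃ i : Fin n, Defined (b i) (b (i + 1))

/-- The relators `a b c⁻¹`, one for every product `ab = c` defined in `P`. -/
def relators (P : Type*) [Pree P] : Set (FreeGroup P) :=
  {r | ∃ a b c : P, pmul a b = some c ∧
    r = FreeGroup.of a * FreeGroup.of b * (FreeGroup.of c)⁻¹}

/-- The universal group `U(P)`, presented by the generators `P` and the relators above. -/
abbrev UniversalGroup (P : Type*) [Pree P] : Type _ :=
  PresentedGroup (relators P)

/-- The canonical map from `P` to its universal group. -/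
def toUniversalGroup {P : Type*} [Pree P] (a : P) : UniversalGroup P :=
  PresentedGroup.of a

end Pree

/-!
The group `U(P)` acts simply transitively on the vertices of its Cayley graph, and the idea is to
build that graph from the local data in `P`, ball by ball around the identity, without knowing
`U(P)`. Call `a, b : P` *adjacent* if `a⁻¹b` is defined. The neighbours of a vertex `v` are
the `v·a`, and `v·a`, `v·b` ought to be joined by an edge labelled `a⁻¹b` when `a` and `b` are
adjacent. Axioms A(4) and A(5) say that every cycle of length 4 or 5 in the adjacency relation has
a diagonal: the links are "6-large", as for locally 6-large (systolic) simplicial complexes.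

A `Pree.Ball` is a set with a partial right action of `P`, total on the interior vertices, in which
the interior neighbours of a sphere vertex are pairwise adjacent and each edge of the sphere has a
common interior neighbour. The first ball is `P` itself. A ball is enlarged (`Pree.Ball.next`) by
adding a vertex for each undefined product `v·x`, where `(v, x)` and `(w, y)` give the same
vertex if `v·p = w` and `py = x` for some `p`. This identification is transitive because of A(5)
and A(4) (`Pree.Ball.defined_of_edges`), the partial action on the new vertices is associative
because of A(4) (`Pree.Ball.outer_assoc`), and the two conditions on the sphere hold again.

Every word in `P` can be followed from the root in all sufficiently large balls. Words that
eventually end at the same vertex are identified; `P` acts on the classes by permutations which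
respect the relators, so `U(P)` acts as well. All balls contain the first one as a full subgraph,
and there the words `ab` and `c` end at the same vertex only if `ab = c` in `P`.
-/

universe u

namespace Pree

/-! ### Calculus in a pree -/

section Calculus

variable {P : Type*} [Pree P] {a b c d e x y z : P}

theorem assoc_iff (h₁ : pmul a b = some x) (h₂ : pmul b c = some y) :
    pmul x c = some z ↔ pmul a y = some z := by
  rw [assoc a b c x y h₁ h₂]

theorem inv_inv' (a : P) : inv (inv a) = a := by
  have h := (assoc_iff (inv_pmul (inv a)) (inv_pmul a)).1 (one_pmul a)
  rw [pmul_one] at h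
  exact Option.some.inj h

theorem inv_pmul_of_pmul (h : pmul a b = some c) : pmul (inv a) c = some b :=
  (assoc_iff (inv_pmul a) h).1 (one_pmul b)

theorem pmul_inv_of_pmul (h : pmul a b = some c) : pmul c (inv b) = some a :=
  (assoc_iff h (pmul_inv b)).2 (pmul_one a)

theorem inv_pmul_inv (h : pmul a b = some c) : pmul (inv b) (inv a) = some (inv c) :=
  pmul_inv_of_pmul (inv_pmul_of_pmul (pmul_inv_of_pmul h))

theorem pmul_of_inv_pmul (h : pmul (inv a) b = some c) : pmul a c = some b := by
  simpa only [inv_inv'] using inv_pmul_of_pmul h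

/-- Two elements `a`, `b` of a pree are adjacent if `a⁻¹b` is defined. This is the adjacency of the
neighbours `v·a`, `v·b` of any vertex `v` of the Cayley graph; it is reflexive. -/
def Adj (a b : P) : Prop := Defined (inv a) b

theorem Adj.symm (h : Adj a b) : Adj b a := by
  obtain ⟨c, hc⟩ := h
  exact ⟨inv c, by simpa only [inv_inv'] using inv_pmul_inv hc⟩

theorem adj_of_pmul (h : pmul a b = some c) : Adj (inv a) b :=
  ⟨c, by rwa [inv_inv']⟩

/-- In terms of adjacency, Axiom A(n) says that a closed path of length `n` has a chord between
vertices at distance two along the path. -/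
theorem AxiomA.exists_adj {n : ℕ} [NeZero n] (hA : AxiomA P n) (a : Fin n → P)
    (h : ∀ i, Adj (a i) (a (i + 1))) : ∃ i, Adj (a i) (a (i + 1 + 1)) := by
  choose b hb using h
  obtain ⟨i, z, hz⟩ := hA a b hb
  exact ⟨i, z, (assoc_iff (hb i) (pmul_of_inv_pmul (hb (i + 1)))).1 hz⟩

theorem AxiomA.diagonal_four (h4 : AxiomA P 4) (hab : Adj a b) (hbc : Adj b c) (hcd : Adj c d)
    (hda : Adj d a) : Adj a c ∨ Adj b d := by
  obtain ⟨i, hi⟩ := h4.exists_adj ![a, b, c, d] (by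
    intro i; fin_cases i <;> assumption)
  fin_cases i
  · exact .inl hi
  · exact .inr hi
  · exact .inl hi.symm
  · exact .inr hi.symm

theorem AxiomA.diagonal_five (h5 : AxiomA P 5) (hab : Adj a b) (hbc : Adj b c) (hcd : Adj c d)
    (hde : Adj d e) (hea : Adj e a) :
    Adj a c ∨ Adj b d ∨ Adj c e ∨ Adj d a ∨ Adj e b := by
  obtain ⟨i, hi⟩ := h5.exists_adj ![a, b, c, d, e] (by
    intro i; fin_cases i <;> assumption)
  fin_cases i
  · exact .inl hi
  · exact .inr (.inl hi)
  · exact .inr (.inr (.inl hi))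
  · exact .inr (.inr (.inr (.inl hi)))
  · exact .inr (.inr (.inr (.inr hi)))

end Calculus

/-! ### Balls -/

/-- A candidate for a ball around the identity in the Cayley graph of `U(P)`. -/
structure Ball (P : Type u) [Pree P] where
  /-- the vertices -/
  V : Type u
  /-- `Rel v p w` means that the vertex `v·p` lies in the ball and is `w`; the partial right action
  is encoded by its graph. -/
  Rel : V → P → V → Prop
  /-- The interior vertices, all of whose neighbours lie in the ball. The other vertices form the
  sphere. -/
  Interior : V → Prop
  /-- the embedding of the ball of radius one, whose vertices are the elements of `P` -/
  unitBall : P → V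
  rel_unitBall : ∀ a p b, Rel (unitBall a) p (unitBall b) ↔ pmul a p = some b
  unique : ∀ {v p w w'}, Rel v p w → Rel v p w' → w = w'
  total : ∀ {v}, Interior v → ∀ p, ∃ w, Rel v p w
  rel_one : ∀ v, Rel v one v
  symm : ∀ {v p w}, Rel v p w → Rel w (inv p) v
  /-- If `v·p = w` and `pq = r`, then `w·q = v·r`, where one side is defined if the other is. -/
  assoc_iff : ∀ {v p w q r z}, Rel v p w → pmul p q = some r → (Rel w q z ↔ Rel v r z)
  /-- The interior neighbours of a sphere vertex are pairwise adjacent. -/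
  adj_of_interior : ∀ {v p q w w'}, ¬ Interior v → Rel v p w → Interior w → Rel v q w' →
    Interior w' → Adj p q
  /-- The end points of an edge of the sphere have a common interior neighbour. -/
  exists_interior : ∀ {v p w}, ¬ Interior v → ¬ Interior w → Rel v p w →
    ∃ q z, Rel v q z ∧ Interior z ∧ Adj p q

namespace Ball

variable {P : Type u} [Pree P]

/-- The ball of radius one. -/
def unit (P : Type u) [Pree P] : Ball P where
  V := P
  Rel a p b := pmul a p = some b
  Interior a := a = one
  unitBall := id
  rel_unitBall _ _ _ := Iff.rfl
  unique h h' := Option.some.inj (h.symm.trans h')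
  total := by
    rintro _ rfl p
    exact ⟨p, one_pmul p⟩
  rel_one := pmul_one
  symm := pmul_inv_of_pmul
  assoc_iff h h' := Pree.assoc_iff h h'
  adj_of_interior := by
    rintro v p q _ _ - hp rfl hq rfl
    have hpq := (inv_pmul_of_pmul hp).symm.trans (inv_pmul_of_pmul hq)
    rw [← Option.some.inj hpq]
    exact ⟨one, inv_pmul p⟩
  exists_interior := by
    intro v p w _ _ h
    exact ⟨inv v, one, pmul_inv v, rfl, inv w, inv_pmul_inv h⟩

variable (B : Ball P)

/-- The product `v·p` leads out of the ball. -/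
def Undef (v : B.V) (p : P) : Prop := ∀ w, ¬ B.Rel v p w

variable {B}

theorem Undef.not_interior {v : B.V} {p : P} (h : B.Undef v p) : ¬ B.Interior v := fun hv =>
  let ⟨w, hw⟩ := B.total hv p
  h w hw

/-- If `w·y` lies outside the ball, then `y` is not adjacent to any `a` for which `w·a` is
interior: otherwise `w·y = (w·a)·(a⁻¹y)` would be defined. -/
theorem Undef.not_adj {w z : B.V} {y a : P} (h : B.Undef w y) (ha : B.Rel w a z)
    (hz : B.Interior z) : ¬ Adj a y := by
  rintro ⟨c, hc⟩
  obtain ⟨t, ht⟩ := B.total hz c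
  exact h t ((B.assoc_iff ha (pmul_of_inv_pmul hc)).1 ht)

theorem Undef.of_rel {v w : B.V} {p x y : P} (hx : B.Undef v x) (h : B.Rel v p w)
    (hp : pmul p y = some x) : B.Undef w y := fun t ht => hx t ((B.assoc_iff h hp).1 ht)

/-- If `v`, `w = v·p`, `u = w·q` are sphere vertices with a common outside neighbour `w·y`, then
`v` and `u` are adjacent. With interior neighbours `w·a` of the edge `vw` and `w·b` of the edge
`wu`, the elements `y, p⁻¹, a, b, q` form a pentagon in which `y` is adjacent to neither `a`
nor `b`. -/
theorem defined_of_edges (h4 : AxiomA P 4) (h5 : AxiomA P 5) {v w u : B.V} {p q x y z : P}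
    (hv : B.Undef v x) (hw : B.Undef w y) (hu : B.Undef u z) (hp : B.Rel v p w)
    (hq : B.Rel w q u) (hx : pmul p y = some x) (hy : pmul q z = some y) : Defined p q := by
  obtain ⟨a, s, ha, hs, hpa⟩ := B.exists_interior hw.not_interior hv.not_interior (B.symm hp)
  obtain ⟨b, t, hb, ht, hqb⟩ := B.exists_interior hw.not_interior hu.not_interior hq
  have hab : Adj a b := B.adj_of_interior hw.not_interior ha hs hb ht
  have hyp : Adj y (inv p) := (adj_of_pmul hx).symm
  have hqy : Adj q y := ⟨z, inv_pmul_of_pmul hy⟩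
  have hya : ¬ Adj y a := fun h => hw.not_adj ha hs h.symm
  have hyb : ¬ Adj y b := fun h => hw.not_adj hb ht h.symm
  have key : Adj (inv p) q := by
    rcases h5.diagonal_five hyp hpa hab hqb.symm hqy with h | h | h | h | h
    · exact absurd h hya
    · exact (h4.diagonal_four hyp h hqb.symm hqy).resolve_left hyb
    · exact (h4.diagonal_four hyp hpa h hqy).resolve_left hya
    · exact absurd h.symm hyb
    · exact h.symm
  obtain ⟨r, hr⟩ := key
  exact ⟨r, by rwa [inv_inv'] at hr⟩

/-! ### Enlarging a ball -/

variable (B) in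
/-- The pairs `(v, x)` for which `v·x` lies outside the ball; they represent the vertices of the
next sphere. -/
abbrev Exit : Type u := {e : B.V × P // B.Undef e.1 e.2}

variable (B) in
/-- Two pairs `(v, x)` and `(w, y)` represent the same new vertex if `v·p = w` and `py = x` for
some `p`. -/
def exitSetoid (h4 : AxiomA P 4) (h5 : AxiomA P 5) : Setoid B.Exit where
  r e f := ∃ p, B.Rel e.1.1 p f.1.1 ∧ pmul p f.1.2 = some e.1.2
  iseqv :=
    { refl := fun e => ⟨one, B.rel_one _, one_pmul _⟩
      symm := by
        rintro e f ⟨p, hp, hx⟩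
        exact ⟨inv p, B.symm hp, inv_pmul_of_pmul hx⟩
      trans := by
        rintro e f g ⟨p, hp, hx⟩ ⟨q, hq, hy⟩
        obtain ⟨r, hr⟩ := defined_of_edges h4 h5 e.2 f.2 g.2 hp hq hx hy
        exact ⟨r, (B.assoc_iff hp hr).1 hq, (Pree.assoc_iff hr hy).2 hx⟩ }

section Next

variable (B) (h4 : AxiomA P 4) (h5 : AxiomA P 5)

/-- The vertices of the next ball. -/
abbrev NextV : Type u := B.V ⊕ Quotient (B.exitSetoid h4 h5)

/-- `Ext v p z` means that `v·p = z` in the next ball, for a vertex `v` of the given ball. -/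
def Ext (v : B.V) (p : P) : B.NextV h4 h5 → Prop
  | .inl w => B.Rel v p w
  | .inr c => ∃ h : B.Undef v p, c = Quotient.mk _ ⟨(v, p), h⟩

/-- The partial action on the next ball. At a new vertex `c = v·x`, the product `c·p` is defined
as `v·(xp)` if `xp` is defined for some representative `(v, x)` of `c`. -/
def NextRel : B.NextV h4 h5 → P → B.NextV h4 h5 → Prop
  | .inl v, p, z => B.Ext h4 h5 v p z
  | .inr c, p, z => ∃ v x y, B.Ext h4 h5 v x (.inr c) ∧ pmul x p = some y ∧ B.Ext h4 h5 v y z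

variable {B h4 h5}

theorem exists_ext (v : B.V) (p : P) : ∃ z, B.Ext h4 h5 v p z := by
  by_cases h : B.Undef v p
  · exact ⟨.inr (Quotient.mk _ ⟨(v, p), h⟩), h, rfl⟩
  · simp only [Undef, not_forall, not_not] at h
    obtain ⟨w, hw⟩ := h
    exact ⟨.inl w, hw⟩

theorem Ext.unique {v : B.V} {p : P} : ∀ {z z' : B.NextV h4 h5},
    B.Ext h4 h5 v p z → B.Ext h4 h5 v p z' → z = z'
  | .inl _, .inl _, h, h' => congrArg _ (B.unique h h')
  | .inl _, .inr _, h, ⟨h', _⟩ => absurd h (h' _)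
  | .inr _, .inl _, ⟨h, _⟩, h' => absurd h' (h _)
  | .inr _, .inr _, ⟨_, e⟩, ⟨_, e'⟩ => congrArg _ (e.trans e'.symm)

/-- The new products are associative over the old edges. -/
theorem ext_iff_of_rel {v w : B.V} {p x y : P} {z : B.NextV h4 h5} (hp : B.Rel v p w)
    (hx : pmul p y = some x) : B.Ext h4 h5 w y z ↔ B.Ext h4 h5 v x z := by
  rcases z with z | c
  · exact B.assoc_iff hp hx
  · constructor
    · rintro ⟨h, rfl⟩
      have h' : B.Undef v x := h.of_rel (B.symm hp) (inv_pmul_of_pmul hx)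
      exact ⟨h', Quotient.sound ⟨inv p, B.symm hp, inv_pmul_of_pmul hx⟩⟩
    · rintro ⟨h, rfl⟩
      exact ⟨h.of_rel hp hx, Quotient.sound ⟨p, hp, hx⟩⟩

/-- Two representatives of a new vertex are joined by an edge of the sphere. -/
theorem exists_rel_of_ext {v w : B.V} {x y : P} {c : Quotient (B.exitSetoid h4 h5)}
    (hv : B.Ext h4 h5 v x (.inr c)) (hw : B.Ext h4 h5 w y (.inr c)) :
    ∃ p, B.Rel v p w ∧ pmul p y = some x := by
  obtain ⟨h, rfl⟩ := hv
  obtain ⟨h', e⟩ := hw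
  exact Quotient.exact e

theorem NextRel.unique {v z z' : B.NextV h4 h5} {p : P} (h : B.NextRel h4 h5 v p z)
    (h' : B.NextRel h4 h5 v p z') : z = z' := by
  rcases v with v | c
  · exact Ext.unique h h'
  · obtain ⟨v, x, y, hv, hxy, hz⟩ := h
    obtain ⟨w, x', y', hw, hxy', hz'⟩ := h'
    obtain ⟨s, hs, hx⟩ := exists_rel_of_ext hv hw
    have hy : pmul s y' = some y := (Pree.assoc_iff hx hxy').1 hxy
    exact Ext.unique hz ((ext_iff_of_rel hs hy).1 hz')

theorem NextRel.symm {v w : B.NextV h4 h5} {p : P} (h : B.NextRel h4 h5 v p w) :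
    B.NextRel h4 h5 w (inv p) v := by
  rcases v with v | c <;> rcases w with w | d
  · exact B.symm h
  · exact ⟨v, p, one, h, pmul_inv p, B.rel_one v⟩
  · obtain ⟨v, x, y, hv, hxy, hw⟩ := h
    exact (ext_iff_of_rel hw (pmul_inv_of_pmul hxy)).2 hv
  · obtain ⟨v, x, y, hv, hxy, hw⟩ := h
    exact ⟨v, y, x, hw, pmul_inv_of_pmul hxy, hv⟩

theorem inner_assoc {v : B.V} {w z : B.NextV h4 h5} {p q r : P} (hp : B.Ext h4 h5 v p w)
    (hr : pmul p q = some r) : B.NextRel h4 h5 w q z ↔ B.Ext h4 h5 v r z := by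
  have key : B.Ext h4 h5 v r z → B.NextRel h4 h5 w q z := fun h => by
    rcases w with w | d
    · exact (ext_iff_of_rel hp hr).2 h
    · exact ⟨v, p, r, hp, hr, h⟩
  refine ⟨fun h => ?_, key⟩
  rcases w with w | d
  · exact (ext_iff_of_rel hp hr).1 h
  · obtain ⟨z', hz'⟩ := exists_ext (h4 := h4) (h5 := h5) v r
    have hd : B.NextRel h4 h5 (.inr d) q z' := ⟨v, p, r, hp, hr, hz'⟩
    rwa [NextRel.unique h hd]

/-- Associativity at a new vertex `c`. The products `c·p` and `c·r` are computed with
representatives `(v, x)` and `(v', x')`; the square `x⁻¹, p, r, x'⁻¹` has a diagonal, so that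
one of the representatives serves for both. -/
theorem outer_assoc {c : Quotient (B.exitSetoid h4 h5)} {w z : B.NextV h4 h5} {p q r : P}
    (hw : B.NextRel h4 h5 (.inr c) p w) (hr : pmul p q = some r)
    (hz : B.NextRel h4 h5 (.inr c) r z) : B.NextRel h4 h5 w q z := by
  have same : ∀ {v x y y'}, B.Ext h4 h5 v x (.inr c) → pmul x p = some y →
      pmul x r = some y' → B.NextRel h4 h5 w q z := by
    intro v x y y' hv hy hy'
    obtain ⟨z', hz'⟩ := exists_ext (h4 := h4) (h5 := h5) v y'
    obtain ⟨w', hw'⟩ := exists_ext (h4 := h4) (h5 := h5) v y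
    have ez : z = z' := NextRel.unique hz ⟨v, x, y', hv, hy', hz'⟩
    have ew : w = w' := NextRel.unique hw ⟨v, x, y, hv, hy, hw'⟩
    subst ez ew
    exact (inner_assoc hw' ((Pree.assoc_iff hy hr).2 hy')).2 hz'
  obtain ⟨v, x, y, hv, hxy, -⟩ := id hw
  obtain ⟨v', x', y', hv', hxy', -⟩ := id hz
  obtain ⟨s, -, hx⟩ := exists_rel_of_ext hv hv'
  have hxx : Adj (inv x') (inv x) := (adj_of_pmul (pmul_inv_of_pmul hx)).symm
  rcases h4.diagonal_four (adj_of_pmul hxy) ⟨q, inv_pmul_of_pmul hr⟩ (adj_of_pmul hxy').symm hxx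
    with ⟨t, ht⟩ | ⟨t, ht⟩
  · rw [inv_inv'] at ht
    exact same hv hxy ht
  · obtain ⟨t', ht'⟩ := Adj.symm ⟨t, ht⟩
    rw [inv_inv'] at ht'
    exact same hv' ht' hxy'

theorem NextRel.assoc_iff {v w z : B.NextV h4 h5} {p q r : P} (hw : B.NextRel h4 h5 v p w)
    (hr : pmul p q = some r) : B.NextRel h4 h5 w q z ↔ B.NextRel h4 h5 v r z := by
  rcases v with v | c
  · exact inner_assoc hw hr
  · refine ⟨fun h => ?_, outer_assoc hw hr⟩
    have hr' : pmul (inv p) r = some q := inv_pmul_of_pmul hr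
    rcases w with w | d
    · have hw' : B.Ext h4 h5 w (inv p) (.inr c) := hw.symm
      exact (inner_assoc hw' hr').2 h
    · exact outer_assoc hw.symm hr' h

variable (B h4 h5)

/-- The ball of the next radius, in which the vertices of the given ball are interior. -/
def next : Ball P where
  V := B.NextV h4 h5
  Rel := B.NextRel h4 h5
  Interior v := v.isLeft
  unitBall a := .inl (B.unitBall a)
  rel_unitBall := B.rel_unitBall
  unique := NextRel.unique
  total := by
    rintro (v | c) hv p
    · exact exists_ext v p
    · simp at hv
  rel_one := by
    rintro (v | c)
    · exact B.rel_one v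
    · induction c using Quotient.inductionOn with
      | h e => exact ⟨e.1.1, e.1.2, e.1.2, ⟨e.2, rfl⟩, pmul_one _, ⟨e.2, rfl⟩⟩
  symm := NextRel.symm
  assoc_iff := NextRel.assoc_iff
  adj_of_interior := by
    rintro (v | c) p q (w | _) (w' | _) hc hw hi hw' hi'
    · simp at hc
    all_goals simp at hc hi hi'
    obtain ⟨s, -, hs⟩ := exists_rel_of_ext hw.symm hw'.symm
    have h := pmul_inv_of_pmul hs
    rw [inv_inv'] at h
    exact ⟨s, h⟩
  exists_interior := by
    rintro (v | c) p (w | d) hc hd h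
    · simp at hc
    · simp at hc
    · simp at hd
    · obtain ⟨v, x, y, hv, hxy, -⟩ := h
      exact ⟨inv x, .inl v, NextRel.symm (v := .inl v) hv, rfl, inv y, inv_pmul_inv hxy⟩

end Next

/-! ### Following words -/

/-- `B.Reach l v` means that the word `l`, read from its last letter to its first, leads inside the
ball from the root to the vertex `v`. -/
def Reach (B : Ball P) : List P → B.V → Prop
  | [], v => v = B.unitBall one
  | p :: l, v => ∃ w, B.Reach l w ∧ B.Rel w p v

theorem Reach.unique {l : List P} {v w : B.V} (hv : B.Reach l v) (hw : B.Reach l w) : v = w := by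
  induction l generalizing v w with
  | nil => exact Eq.trans hv (Eq.symm hw)
  | cons p l ih =>
    obtain ⟨v', hv', h⟩ := hv
    obtain ⟨w', hw', h'⟩ := hw
    obtain rfl := ih hv' hw'
    exact B.unique h h'

theorem reach_singleton {a : P} {v : B.V} : B.Reach [a] v ↔ v = B.unitBall a := by
  have h : B.Rel (B.unitBall one) a (B.unitBall a) := (B.rel_unitBall _ _ _).2 (one_pmul a)
  constructor
  · rintro ⟨_, rfl, hv⟩
    exact B.unique hv h
  · rintro rfl
    exact ⟨_, rfl, h⟩

variable (h4 : AxiomA P 4) (h5 : AxiomA P 5)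

theorem Reach.next {l : List P} {v : B.V} (h : B.Reach l v) :
    (B.next h4 h5).Reach l (.inl v) := by
  induction l generalizing v with
  | nil => exact congrArg Sum.inl h
  | cons p l ih =>
    obtain ⟨w, hw, hp⟩ := h
    exact ⟨.inl w, ih hw, hp⟩

/-- The ball of radius `n + 1`. -/
def ball : ℕ → Ball P
  | 0 => unit P
  | n + 1 => (ball n).next h4 h5

theorem exists_reach {l : List P} {n : ℕ} (h : l.length ≤ n) : ∃ v, (ball h4 h5 n).Reach l v := by
  induction n generalizing l with
  | zero =>
    obtain rfl := List.length_eq_zero_iff.1 (Nat.le_zero.1 h)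
    exact ⟨_, rfl⟩
  | succ n ih =>
    cases l with
    | nil => exact ⟨_, rfl⟩
    | cons p l =>
      obtain ⟨v, hv⟩ := ih (Nat.le_of_succ_le_succ h)
      obtain ⟨w, hw⟩ := ((ball h4 h5 n).next h4 h5).total (v := .inl v) rfl p
      exact ⟨w, .inl v, hv.next h4 h5, hw⟩

end Ball

/-! ### The action of the universal group -/

section Action

open Filter

variable {P : Type u} [Pree P] (h4 : AxiomA P 4) (h5 : AxiomA P 5)

/-- Two words are identified if they lead to the same vertex in all sufficiently large balls. -/
def wordSetoid : Setoid (List P) where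
  r l m := ∀ᶠ n in atTop, ∃ v, (Ball.ball h4 h5 n).Reach l v ∧ (Ball.ball h4 h5 n).Reach m v
  iseqv :=
    { refl := fun l => by
        filter_upwards [eventually_ge_atTop l.length] with n hn
        obtain ⟨v, hv⟩ := Ball.exists_reach h4 h5 hn
        exact ⟨v, hv, hv⟩
      symm := fun h => h.mono fun n ⟨v, hl, hm⟩ => ⟨v, hm, hl⟩
      trans := fun h h' => by
        filter_upwards [h, h'] with n ⟨v, hl, hm⟩ ⟨w, hm', hk⟩
        obtain rfl := hm.unique hm'
        exact ⟨v, hl, hk⟩ }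

/-- The vertices of the whole Cayley graph, as classes of words. -/
abbrev Vertex : Type u := Quotient (wordSetoid h4 h5)

/-- The right action of an element of `P` on the vertices. Words are read backwards, so that it
adds a first letter. -/
def step (p : P) : Vertex h4 h5 → Vertex h4 h5 :=
  Quotient.map (List.cons p) fun l m (h : ∀ᶠ n in atTop, _) => by
    filter_upwards [h, eventually_ge_atTop (p :: l).length] with n ⟨v, hl, hm⟩ hn
    obtain ⟨w, v', hv', hw⟩ := Ball.exists_reach h4 h5 hn
    obtain rfl := hl.unique hv'
    exact ⟨w, ⟨v, hl, hw⟩, ⟨v, hm, hw⟩⟩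

theorem step_step {p q r : P} (h : pmul p q = some r) (v : Vertex h4 h5) :
    step h4 h5 q (step h4 h5 p v) = step h4 h5 r v := by
  induction v using Quotient.inductionOn with
  | h l =>
    refine Quotient.sound (s := wordSetoid h4 h5) ?_
    filter_upwards [eventually_ge_atTop (q :: p :: l).length] with n hn
    obtain ⟨w, v, ⟨u, hu, hv⟩, hw⟩ := Ball.exists_reach h4 h5 hn
    exact ⟨w, ⟨v, ⟨u, hu, hv⟩, hw⟩, u, hu, ((Ball.ball h4 h5 n).assoc_iff hv h).1 hw⟩

theorem step_one (v : Vertex h4 h5) : step h4 h5 one v = v := by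
  induction v using Quotient.inductionOn with
  | h l =>
    refine Quotient.sound (s := wordSetoid h4 h5) ?_
    filter_upwards [eventually_ge_atTop l.length] with n hn
    obtain ⟨v, hv⟩ := Ball.exists_reach h4 h5 hn
    exact ⟨v, ⟨v, hv, (Ball.ball h4 h5 n).rel_one v⟩, hv⟩

/-- `step` as a permutation, in the opposite group because the action is a right action. -/
def stepPerm (p : P) : (Equiv.Perm (Vertex h4 h5))ᵐᵒᵖ :=
  .op
    { toFun := step h4 h5 p
      invFun := step h4 h5 (inv p)
      left_inv := fun v => by rw [step_step h4 h5 (pmul_inv p), step_one]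
      right_inv := fun v => by rw [step_step h4 h5 (inv_pmul p), step_one] }

theorem stepPerm_mul {p q r : P} (h : pmul p q = some r) :
    stepPerm h4 h5 p * stepPerm h4 h5 q = stepPerm h4 h5 r :=
  MulOpposite.unop_injective (Equiv.ext (step_step h4 h5 h))

/-- The right action of the universal group on the vertices. -/
def universalAction : UniversalGroup P →* (Equiv.Perm (Vertex h4 h5))ᵐᵒᵖ :=
  PresentedGroup.toGroup (f := stepPerm h4 h5) (by
    rintro _ ⟨a, b, c, h, rfl⟩
    simp [stepPerm_mul h4 h5 h])

theorem universalAction_apply (a : P) :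
    universalAction h4 h5 (toUniversalGroup a) = stepPerm h4 h5 a :=
  PresentedGroup.toGroup.of _

end Action

theorem toUniversalGroup_mul {P : Type*} [Pree P] {a b c : P} (h : pmul a b = some c) :
    toUniversalGroup a * toUniversalGroup b = (toUniversalGroup c : UniversalGroup P) :=
  mul_inv_eq_one.1 (PresentedGroup.one_of_mem (rels := relators P) ⟨a, b, c, h, rfl⟩)

theorem toUniversalGroup_one {P : Type*} [Pree P] :
    (toUniversalGroup one : UniversalGroup P) = 1 :=
  mul_eq_left.1 (toUniversalGroup_mul (one_pmul one))

theorem pmul_of_toUniversalGroup_mul {P : Type*} [Pree P] (h4 : AxiomA P 4) (h5 : AxiomA P 5)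
    {a b c : P}
    (h : toUniversalGroup a * toUniversalGroup b = (toUniversalGroup c : UniversalGroup P)) :
    pmul a b = some c := by
  have h' := congrArg (universalAction h4 h5) h
  rw [map_mul, universalAction_apply, universalAction_apply, universalAction_apply] at h'
  -- Both sides are applied to the root, the class of the empty word.
  have hw : (Quotient.mk (wordSetoid h4 h5) [b, a]) = Quotient.mk _ [c] :=
    congrArg (fun g : (Equiv.Perm (Vertex h4 h5))ᵐᵒᵖ =>
      g.unop (Quotient.mk (wordSetoid h4 h5) [])) h'
  obtain ⟨n, v, ⟨w, hw, hb⟩, hc⟩ := Filter.Eventually.exists (Quotient.exact hw)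
  rw [Ball.reach_singleton] at hw hc
  subst hw hc
  exact ((Ball.ball h4 h5 n).rel_unitBall a b c).1 hb

end Pree

theorem theorem4 {P : Type*} [Pree P] (h4 : Pree.AxiomA P 4) (h5 : Pree.AxiomA P 5) :
    Function.Injective (Pree.toUniversalGroup : P → Pree.UniversalGroup P) ∧
      ∀ a b c : P, Pree.pmul a b = some c ↔
        Pree.toUniversalGroup a * Pree.toUniversalGroup b = Pree.toUniversalGroup c := by
  refine ⟨fun a b h => ?_, fun a b c =>
    ⟨Pree.toUniversalGroup_mul, Pree.pmul_of_toUniversalGroup_mul h4 h5⟩⟩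
  have h' : Pree.pmul a Pree.one = some b :=
    Pree.pmul_of_toUniversalGroup_mul h4 h5 (by rw [Pree.toUniversalGroup_one, mul_one, h])
  rw [Pree.pmul_one] at h'
  exact Option.some.inj h'
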